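/- Let $\mathcal H$ be a complex separable Hilbert space and let $F\colon\mathcal H\to\mathcal K$ be a frame, that is, a Hilbert--Schmidt operator with trivial kernel and dense range, where $\mathcal K$ is another complex Hilbert space. Let $H_0$ be a (possibly unbounded) self-adjoint operator on $\mathcal H$, let $V=F^*JF$ where $J$ is a bounded self-adjoint operator on $\mathcal K$, and let $H_s=H_0+sV$, $s\in\mathbb R$. For non-real $w$ write $R_w(H)=(H-w)^{-1}$, and write $\operatorname{Im}A=\frac1{2i}(A-A^*)$ for a bounded operator $A$. Let $z\in\mathbb C\setminus\mathbb R$. Then for every real $s$ the operator $\frac1\pi\operatorname{Im}R_z(H_s)V$ is trace class, and the function $$F_z(s)=\operatorname{Tr}\Bigl(\frac1\pi\operatorname{Im}R_z(H_s)V\Bigr),\qquad s\in\mathbb R,$$ admits a meromorphic continuation, again denoted by $F_z$, to the whole complex plane. If $s_0\in\mathbb C$ is a pole of $F_z$, then $s_0$ is non-real and $$2\pi i\,\operatorname*{Res}_{s=s_0}F_z(s)=N_+-N_-,$$ where $N_+$ (respectively, $N_-$) is the algebraic multiplicity of $-1/s_0$ as an eigenvalue of $R_z(H_0)V$ (respectively,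 of $R_{\bar z}(H_0)V$), that is, the dimension of the root space $\bigcup_{n\ge1}\ker\bigl(R_z(H_0)V+s_0^{-1}\bigr)^n$ (respectively, $\bigcup_{n\ge1}\ker\bigl(R_{\bar z}(H_0)V+s_0^{-1}\bigr)^n$); both dimensions are finite, and the multiplicity is $0$ if $-1/s_0$ is not an eigenvalue. -/

import Mathlib

open scoped InnerProductSpace ComplexStarModule Topology

noncomputable section

namespace ResonanceIndex

universe u v

/-! ### Hilbert–Schmidt and trace class operators, the trace -/

section Trace

variable (E : Type u) [NormedAddCommGroup E] [InnerProductSpace ℂ E] [CompleteSpace E]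

/-- The index set of a fixed orthonormal (Hilbert) basis of `E`. -/
def basisIndex : Set E := (exists_hilbertBasis ℂ E).choose

/-- A fixed orthonormal (Hilbert) basis of `E`. The notions below do not depend on its choice. -/
def basis : HilbertBasis (basisIndex E) ℂ E := (exists_hilbertBasis ℂ E).choose_spec.choose

variable {E}

/-- `T` is a Hilbert–Schmidt operator: `∑ ‖T eᵢ‖² < ∞` for an orthonormal basis `(eᵢ)`. -/
def IsHilbertSchmidt {G : Type v} [NormedAddCommGroup G] [InnerProductSpace ℂ G]
    (T : E →L[ℂ] G) : Prop :=
  Summable fun i : basisIndex E => ‖T (basis E i)‖ ^ 2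

/-- `T` is a trace class operator: `Tr |T| < ∞`, where `|T| = (T* T)^{1/2}`. -/
def IsTraceClass (T : E →L[ℂ] E) : Prop :=
  Summable fun i : basisIndex E => (⟪basis E i, CFC.abs T (basis E i)⟫_ℂ).re

/-- The trace `Tr T = ∑ ⟨eᵢ, T eᵢ⟩` (of a trace class operator `T`). -/
def trace (T : E →L[ℂ] E) : ℂ :=
  ∑' i : basisIndex E, ⟪basis E i, T (basis E i)⟫_ℂ

/-- A frame: a Hilbert–Schmidt operator with trivial kernel and trivial co-kernel. -/
structure IsFrame {K : Type v} [NormedAddCommGroup K] [InnerProductSpace ℂ K]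
    (F : E →L[ℂ] K) : Prop where
  hilbertSchmidt : IsHilbertSchmidt F
  injective : Function.Injective F
  denseRange : DenseRange F

end Trace

/-! ### Unbounded operators, their resolvents and the path `H_s = H₀ + s V` -/

section Resolvent

variable {E : Type u} [NormedAddCommGroup E] [InnerProductSpace ℂ E]

/-- The bounded operator `R` is a two-sided inverse of `T - z : dom T → E`. -/
def IsResolventAt (T : E →ₗ.[ℂ] E) (z : ℂ) (R : E →L[ℂ] E) : Prop :=
  (∀ x : E, ∃ h : R x ∈ T.domain, T ⟨R x, h⟩ - z • R x = x) ∧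
    ∀ y : T.domain, R (T y - z • (y : E)) = y

/-- The bounded inverse of `T - z` is unique. -/
theorem IsResolventAt.unique {T : E →ₗ.[ℂ] E} {z : ℂ} {R R' : E →L[ℂ] E}
    (h : IsResolventAt T z R) (h' : IsResolventAt T z R') : R = R' := by
  ext x
  obtain ⟨hx, e⟩ := h.1 x
  have := h'.2 ⟨R x, hx⟩
  rw [e] at this
  exact this.symm

open Classical in
/-- The resolvent `R_z(T) = (T - z)⁻¹`; it is set to be `0` when `T - z` has no bounded inverse,
which does not happen for self-adjoint `T` and non-real `z`. -/
def resolventOp (T : E →ₗ.[ℂ] E) (z : ℂ) : E →L[ℂ] E :=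
  if h : ∃ R : E →L[ℂ] E, IsResolventAt T z R then h.choose else 0

/-- The operator `H_s = H₀ + s V`, with domain `dom H₀`, for real `s` and bounded `V`. -/
def path (H₀ : E →ₗ.[ℂ] E) (V : E →L[ℂ] E) (s : ℝ) : E →ₗ.[ℂ] E :=
  (((s : ℂ) • V : E →L[ℂ] E) : E →ₗ[ℂ] E) +ᵥ H₀

variable [CompleteSpace E]

/-- The bounded operator `(1/π) Im R_z(H_s) V`, for real `s`, where `Im A = (A - A*) / (2i)`. -/
def imResolventMul (H₀ : E →ₗ.[ℂ] E) (V : E →L[ℂ] E) (z : ℂ) (s : ℝ) : E →L[ℂ] E :=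
  ((1 / Real.pi : ℝ) : ℂ) • ((ℑ (resolventOp (path H₀ V s) z) : E →L[ℂ] E) ∘L V)

/-- `G` is a meromorphic function on the complex plane which extends the function
`F_z(s) = Tr ((1/π) Im R_z(H_s) V)` of the real variable `s`. -/
def IsMeromorphicExtension (H₀ : E →ₗ.[ℂ] E) (V : E →L[ℂ] E) (z : ℂ) (G : ℂ → ℂ) : Prop :=
  Meromorphic G ∧ ∀ s : ℝ, G s = trace (imResolventMul H₀ V z s)

/-- The root space of `A` for the number `t`, `⋃ₙ ker (A - t)ⁿ`. Its dimension is the algebraic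
multiplicity of `t` as an eigenvalue of `A`. -/
def rootSpace (A : E →L[ℂ] E) (t : ℂ) : Submodule ℂ E :=
  Module.End.maxGenEigenspace (A : E →ₗ[ℂ] E) t

end Resolvent

/-- `G` has a pole at `s₀` (`G` is meromorphic of negative order at `s₀`). -/
def IsPole (G : ℂ → ℂ) (s₀ : ℂ) : Prop :=
  MeromorphicAt G s₀ ∧ meromorphicOrderAt G s₀ < 0

/-- `a` is the residue of `G` at `s₀`: `a = (2πi)⁻¹ ∮ G(s) ds` over all small enough circles
centered at `s₀`, oriented anticlockwise. -/
def HasResidueAt (G : ℂ → ℂ) (s₀ a : ℂ) : Prop :=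
  ∀ᶠ ρ : ℝ in 𝓝[>] 0, (2 * Real.pi * Complex.I)⁻¹ * (∮ s in C(s₀, ρ), G s) = a

end ResonanceIndex

end

noncomputable section

set_option linter.unusedSectionVars false

namespace ResonanceIndex

open scoped ENNReal ComplexOrder
open ContinuousLinearMap Filter

/-! ### Hilbert–Schmidt operators. -/

section HilbertSchmidt

variable {E : Type*} [NormedAddCommGroup E] [InnerProductSpace ℂ E]
  {G : Type*} [NormedAddCommGroup G] [InnerProductSpace ℂ G]
  {G' : Type*} [NormedAddCommGroup G'] [InnerProductSpace ℂ G']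

/-! Put `A = R_z(H₀) V` and `A' = R_{z̄}(H₀) V`. For real `s` the resolvent of `H_s` is `(1 + sA)⁻¹
R_z(H₀)`, and its adjoint is the resolvent at `z̄`, so `F_z(s) = (2πi)⁻¹ (Tr (1 + sA)⁻¹A - Tr (1 +
sA')⁻¹A')`. The right side makes sense for complex `s` and is the continuation.

Write `V = QF` with `Q = F*J`; `F` and `Q*` are Hilbert–Schmidt. Hence `X ↦ Tr (XQF)` is a bounded
functional (`exists_trace_functional`), which turns operator analyticity into analyticity of traces,
and `A`, `A'` are compact. Symmetry of `H_s` makes `1 + sA` invertible for real `s`, so there are no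
real poles.

Near `s₀ ≠ 0`, let `N` be the root space of `A` for `-1/s₀` and `p` the orthogonal projection onto
its complement. Since `p(1 + sA)⁻¹ = (1 + s pA)⁻¹p` and `1 + s₀ pA` is invertible, this part is
analytic. On `N`, `A` is `-1/s₀` plus a nilpotent, so `(1 + sA)⁻¹A` is `(s - s₀)⁻¹` plus a nilpotent
and has trace `dim N/(s - s₀)` (`exists_analyticAt_trace_eq`). Subtracting the same statement for
`A'` gives the residue. By the identity theorem any other continuation agrees with this one near
`s₀`, off `s₀` itself. -/

theorem enorm_sq_eq_ofReal {X : Type*} [SeminormedAddGroup X] (x : X) :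
    ‖x‖ₑ ^ 2 = ENNReal.ofReal (‖x‖ ^ 2) := by
  rw [ENNReal.ofReal_pow (norm_nonneg _), ofReal_norm]

theorem tsum_enorm_inner_sq_le {ι : Type*} {v : ι → E} (hv : Orthonormal ℂ v) (x : E) :
    ∑' i, ‖⟪v i, x⟫_ℂ‖ₑ ^ 2 ≤ ‖x‖ₑ ^ 2 := by
  simp_rw [enorm_sq_eq_ofReal]
  rw [← ENNReal.ofReal_tsum_of_nonneg (fun _ => by positivity) (hv.inner_products_summable x)]
  exact ENNReal.ofReal_le_ofReal (hv.tsum_inner_products_le x)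

theorem tsum_enorm_inner_sq_eq {ι : Type*} (b : HilbertBasis ι ℂ E) (x : E) :
    ∑' i, ‖⟪b i, x⟫_ℂ‖ₑ ^ 2 = ‖x‖ₑ ^ 2 := by
  have h := Complex.hasSum_re (b.hasSum_inner_mul_inner x x)
  have h2 : HasSum (fun i => ‖⟪b i, x⟫_ℂ‖ ^ 2) (‖x‖ ^ 2) := by
    convert h using 1
    · ext i
      rw [← inner_conj_symm x (b i), mul_comm, Complex.mul_conj, Complex.ofReal_re,
        Complex.normSq_eq_norm_sq]
    · exact (inner_self_eq_norm_sq (𝕜 := ℂ) x).symm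
  simp_rw [enorm_sq_eq_ofReal]
  rw [← ENNReal.ofReal_tsum_of_nonneg (fun _ => by positivity) h2.summable, h2.tsum_eq]

variable [CompleteSpace E]

/-- The square of the Hilbert–Schmidt norm. -/
def hsSq (T : E →L[ℂ] G) : ℝ≥0∞ := ∑' i : basisIndex E, ‖T (basis E i)‖ₑ ^ 2

theorem IsHilbertSchmidt.hsSq_ne_top {T : E →L[ℂ] G} (h : IsHilbertSchmidt T) : hsSq T ≠ ⊤ := by
  simp_rw [hsSq, enorm_sq_eq_ofReal]
  rw [← ENNReal.ofReal_tsum_of_nonneg (fun _ => by positivity) h]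
  exact ENNReal.ofReal_ne_top

theorem hasSum_hsSq {T : E →L[ℂ] G} (h : hsSq T ≠ ⊤) :
    HasSum (fun i : basisIndex E => ‖T (basis E i)‖ ^ 2) (hsSq T).toReal := by
  simp_rw [hsSq, enorm_sq_eq_ofReal] at h ⊢
  have h1 := (ENNReal.hasSum_toReal h)
  rw [← ENNReal.tsum_toReal_eq (ENNReal.ne_top_of_tsum_ne_top h)] at h1
  simpa only [ENNReal.toReal_ofReal (sq_nonneg _)] using h1

theorem hsSq_comp_le (S : G →L[ℂ] G') (T : E →L[ℂ] G) : hsSq (S ∘L T) ≤ ‖S‖ₑ ^ 2 * hsSq T := by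
  rw [hsSq, hsSq, ← ENNReal.tsum_mul_left]
  refine ENNReal.tsum_le_tsum fun i => ?_
  rw [← mul_pow]
  gcongr
  exact S.le_opENorm _

theorem hsSq_comp_ne_top (S : G →L[ℂ] G') {T : E →L[ℂ] G} (h : hsSq T ≠ ⊤) :
    hsSq (S ∘L T) ≠ ⊤ :=
  ne_top_of_le_ne_top (ENNReal.mul_ne_top (by simp) h) (hsSq_comp_le S T)

variable [CompleteSpace G] [CompleteSpace G']

/-- Parseval and an exchange of nonnegative sums. With `v` a Hilbert basis it gives invariance under
adjoints; with `v` merely orthonormal, Bessel gives an upper bound by `hsSq`. -/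
theorem tsum_enorm_sq_swap {ι κ : Type*} (v : ι → E) (c : HilbertBasis κ ℂ G) (T : E →L[ℂ] G) :
    ∑' i, ‖T (v i)‖ₑ ^ 2 = ∑' j, ∑' i, ‖⟪v i, adjoint T (c j)⟫_ℂ‖ₑ ^ 2 := by
  rw [ENNReal.tsum_comm]
  congr! 2 with i
  rw [← tsum_enorm_inner_sq_eq c]
  congr! 2 with j
  rw [← adjoint_inner_left, enorm_sq_eq_ofReal, enorm_sq_eq_ofReal, norm_inner_symm]

theorem hsSq_adjoint (T : E →L[ℂ] G) : hsSq (adjoint T) = hsSq T := by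
  rw [hsSq, hsSq, tsum_enorm_sq_swap _ (basis G)]
  simp_rw [tsum_enorm_inner_sq_eq]

theorem tsum_enorm_sq_le_hsSq {ι : Type*} {v : ι → E} (hv : Orthonormal ℂ v) (T : E →L[ℂ] G) :
    ∑' i, ‖T (v i)‖ₑ ^ 2 ≤ hsSq T := by
  rw [tsum_enorm_sq_swap _ (basis G), ← hsSq_adjoint, hsSq]
  exact ENNReal.tsum_le_tsum fun j => tsum_enorm_inner_sq_le hv _

theorem sum_norm_sq_le_hsSq {ι : Type*} [Fintype ι] {v : ι → E} (hv : Orthonormal ℂ v)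
    {T : E →L[ℂ] G} (hT : hsSq T ≠ ⊤) : ∑ i, ‖T (v i)‖ ^ 2 ≤ (hsSq T).toReal := by
  have h := tsum_enorm_sq_le_hsSq hv T
  rw [tsum_fintype] at h
  rw [← ENNReal.ofReal_le_iff_le_toReal hT, ENNReal.ofReal_sum_of_nonneg (fun _ _ => by positivity)]
  simpa only [enorm_sq_eq_ofReal] using h

theorem hsSq_comp_le' (S : G →L[ℂ] G') (T : E →L[ℂ] G) : hsSq (S ∘L T) ≤ ‖T‖ₑ ^ 2 * hsSq S := by
  rw [← hsSq_adjoint, adjoint_comp, ← hsSq_adjoint S, ← enorm_norm T,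
    ← LinearIsometryEquiv.norm_map (adjoint : (E →L[ℂ] G) ≃ₗᵢ⋆[ℂ] _), enorm_norm]
  exact hsSq_comp_le _ _

theorem hsSq_comp_ne_top' {S : G →L[ℂ] G'} (T : E →L[ℂ] G) (h : hsSq S ≠ ⊤) :
    hsSq (S ∘L T) ≠ ⊤ :=
  ne_top_of_le_ne_top (ENNReal.mul_ne_top (by simp) h) (hsSq_comp_le' S T)

theorem toReal_hsSq_comp_le' {S : G →L[ℂ] G'} (T : E →L[ℂ] G) (h : hsSq S ≠ ⊤) :
    (hsSq (S ∘L T)).toReal ≤ ‖T‖ ^ 2 * (hsSq S).toReal := by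
  have := ENNReal.toReal_mono (ENNReal.mul_ne_top (by simp) h) (hsSq_comp_le' S T)
  simpa using this

theorem enorm_sq_le_hsSq (T : E →L[ℂ] G) : ‖T‖ₑ ^ 2 ≤ hsSq T := by
  by_cases hT : hsSq T = ⊤
  · simp [hT]
  have hb : ‖T‖ ≤ √(hsSq T).toReal := by
    refine T.opNorm_le_of_unit_norm (Real.sqrt_nonneg _) fun x hx => ?_
    have := sum_norm_sq_le_hsSq (v := fun _ : Unit => x) ⟨fun _ => hx, fun i j h => by simp at h⟩ hT
    exact Real.le_sqrt_of_sq_le (by simpa using this)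
  rw [enorm_sq_eq_ofReal, ENNReal.ofReal_le_iff_le_toReal hT]
  exact (Real.le_sqrt (norm_nonneg _) ENNReal.toReal_nonneg).1 hb

/-- The finite-rank truncations converge in operator norm, because the Hilbert–Schmidt norm
dominates it and the tails of `hsSq` vanish. -/
theorem isCompactOperator_of_hsSq_ne_top {T : E →L[ℂ] G} (hT : hsSq T ≠ ⊤) :
    IsCompactOperator T := by
  classical
  let P (s : Finset (basisIndex E)) : E →L[ℂ] G :=
    ∑ i ∈ s, (innerSL ℂ (basis E i)).smulRight (T (basis E i))
  have hP (s : Finset (basisIndex E)) : IsCompactOperator (P s) := by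
    refine Finset.sum_induction _ (fun S : E →L[ℂ] G => IsCompactOperator S)
      (fun S S' h h' => h.add h') isCompactOperator_zero fun i _ => ?_
    have h1 : IsCompactOperator (innerSL ℂ (basis E i)) :=
      isCompactOperator_of_locallyCompactSpace_dom _
    exact h1.clm_comp ((ContinuousLinearMap.id ℂ ℂ).smulRight (T (basis E i)))
  have hPb (s : Finset (basisIndex E)) (j : basisIndex E) :
      P s (basis E j) = if j ∈ s then T (basis E j) else 0 := by
    simp only [P, sum_apply, smulRight_apply, innerSL_apply_apply,
      orthonormal_iff_ite.1 (basis E).orthonormal, ite_smul, one_smul, zero_smul]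
    simp
  have hsq (s : Finset (basisIndex E)) :
      hsSq (T - P s) = ∑' i : {i // i ∉ s}, ‖T (basis E i)‖ₑ ^ 2 := by
    rw [hsSq, ← tsum_subtype_eq_of_support_subset (s := {i | i ∉ s})]
    · refine tsum_congr fun i => ?_
      rw [sub_apply, hPb, if_neg i.2, sub_zero]
    · intro i hi his
      rw [Function.mem_support, sub_apply, hPb, if_pos his, sub_self] at hi
      simp at hi
  have h0 : Tendsto (fun s => hsSq (T - P s)) atTop (𝓝 0) := by
    simp_rw [hsq]
    exact ENNReal.tendsto_tsum_compl_atTop_zero hT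
  have h1 : Tendsto (fun s => ‖T - P s‖ₑ ^ 2) atTop (𝓝 0) :=
    tendsto_of_tendsto_of_tendsto_of_le_of_le tendsto_const_nhds h0 (fun _ => zero_le)
      fun s => enorm_sq_le_hsSq _
  have h2 : Tendsto P atTop (𝓝 T) := by
    rw [tendsto_iff_norm_sub_tendsto_zero]
    have h3 := (ENNReal.tendsto_toReal ENNReal.zero_ne_top).comp h1
    have h4 := (Real.continuous_sqrt.tendsto 0).comp (by simpa [Function.comp_def] using h3)
    simpa [Function.comp_def, norm_sub_rev] using h4
  exact isCompactOperator_of_tendsto h2 (Eventually.of_forall hP)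

end HilbertSchmidt

theorem norm_inner_le_half {G : Type*} [NormedAddCommGroup G] [InnerProductSpace ℂ G] (x y : G) :
    ‖⟪x, y⟫_ℂ‖ ≤ (‖x‖ ^ 2 + ‖y‖ ^ 2) / 2 := by
  have := norm_inner_le_norm (𝕜 := ℂ) x y
  nlinarith [sq_nonneg (‖x‖ - ‖y‖)]

/-! ### Trace class operators and the trace. -/

section TraceClass

variable {E : Type*} [NormedAddCommGroup E] [InnerProductSpace ℂ E] [CompleteSpace E]
  {G : Type*} [NormedAddCommGroup G] [InnerProductSpace ℂ G] [CompleteSpace G]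

theorem inner_abs_abs (T : E →L[ℂ] E) (x y : E) :
    ⟪CFC.abs T x, CFC.abs T y⟫_ℂ = ⟪T x, T y⟫_ℂ := by
  have hA : IsSelfAdjoint (CFC.abs T) := (CFC.abs_nonneg T).isSelfAdjoint
  have h := CFC.abs_mul_abs T
  rw [← adjoint_inner_right, ← adjoint_inner_right, ← star_eq_adjoint, hA.star_eq,
    ← star_eq_adjoint]
  exact congr(⟪x, $h y⟫_ℂ)

theorem norm_abs_apply (T : E →L[ℂ] E) (x : E) : ‖CFC.abs T x‖ = ‖T x‖ := by
  rw [← sq_eq_sq₀ (norm_nonneg _) (norm_nonneg _), ← inner_self_eq_norm_sq (𝕜 := ℂ),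
    ← inner_self_eq_norm_sq (𝕜 := ℂ), inner_abs_abs]

theorem inner_abs_nonneg (T : E →L[ℂ] E) (x : E) : 0 ≤ (⟪x, CFC.abs T x⟫_ℂ).re :=
  ((nonneg_iff_isPositive _).1 (CFC.abs_nonneg T)).re_inner_nonneg_right x

/-- For `ε > 0` the operator `|T| + ε` has a bounded self-adjoint inverse `D`, and `T D` is a
contraction. -/
theorem exists_inverse_abs_add (T : E →L[ℂ] E) {ε : ℝ} (hε : 0 < ε) :
    ∃ D : E →L[ℂ] E, IsSelfAdjoint D ∧ D * (CFC.abs T + (ε : ℂ) • 1) = 1 ∧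
      ∀ x, ‖T (D x)‖ ≤ ‖x‖ := by
  set A := CFC.abs T
  have hA : IsSelfAdjoint A := (CFC.abs_nonneg T).isSelfAdjoint
  have hsa : IsSelfAdjoint (A + (ε : ℂ) • 1) :=
    hA.add (IsSelfAdjoint.smul (by simp [isSelfAdjoint_iff]) (.one _))
  have hu : IsUnit (A + (ε : ℂ) • 1) := by
    have h : (-ε : ℂ) ∉ spectrum ℂ A := fun h => by
      have := spectrum_nonneg_of_nonneg (CFC.abs_nonneg T) h
      rw [← Complex.ofReal_neg, Complex.zero_le_real] at this
      linarith
    rw [spectrum.notMem_iff, ← IsUnit.neg_iff] at h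
    convert h using 1
    simp [Algebra.algebraMap_eq_smul_one]
  obtain ⟨u, hu⟩ := hu
  refine ⟨((u⁻¹ : (E →L[ℂ] E)ˣ) : E →L[ℂ] E), ?_, by rw [← hu]; simp, fun x => ?_⟩
  · rw [isSelfAdjoint_iff, ← Units.coe_star_inv]
    congr 2
    ext1
    rw [Units.coe_star, hu, hsa.star_eq]
  · set y := ((u⁻¹ : (E →L[ℂ] E)ˣ) : E →L[ℂ] E) x with hy
    have hx : x = A y + (ε : ℂ) • y := by
      have : x = ((u : E →L[ℂ] E) * ((u⁻¹ : (E →L[ℂ] E)ˣ) : E →L[ℂ] E)) x := by simp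
      rw [this, hu]
      change _ + (ε : ℂ) • y = _
      rfl
    rw [← norm_abs_apply, ← sq_le_sq₀ (norm_nonneg _) (norm_nonneg _), hx,
      norm_add_sq (𝕜 := ℂ), inner_smul_right]
    have h1 : 0 ≤ (⟪A y, y⟫_ℂ).re := by
      rw [← inner_conj_symm, Complex.conj_re]; exact inner_abs_nonneg T y
    have h2 : RCLike.re ((ε : ℂ) * ⟪A y, y⟫_ℂ) = ε * (⟪A y, y⟫_ℂ).re := by
      simp
    rw [h2]
    nlinarith [mul_nonneg hε.le h1, sq_nonneg ‖(ε : ℂ) • y‖]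

/-- The operator `T D`, with `D = (|T| + ε)⁻¹`, is a contraction standing in for the partial
isometry of the polar decomposition. Up to an error of order `ε`, `|T|` is `(T D)* Q P`, whose
diagonal entries are controlled by the two Hilbert–Schmidt norms. -/
theorem isTraceClass_comp {P : E →L[ℂ] G} {Q : G →L[ℂ] E} (hP : hsSq P ≠ ⊤)
    (hQ : hsSq (adjoint Q) ≠ ⊤) : IsTraceClass (Q ∘L P) := by
  set T := Q ∘L P with hT
  refine summable_of_sum_le (c := ((hsSq (adjoint Q)).toReal + (hsSq P).toReal) / 2)
    (fun i => inner_abs_nonneg T _) fun s => ?_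
  refine le_of_forall_pos_le_add fun δ hδ => ?_
  -- Each of the finitely many diagonal entries costs an error `ε`, so `ε` is chosen after the
  -- finite set.
  obtain ⟨ε, hε, hεδ⟩ : ∃ ε : ℝ, 0 < ε ∧ s.card * ε ≤ δ := by
    refine ⟨δ / (s.card + 1), by positivity, ?_⟩
    rw [mul_div_assoc', div_le_iff₀ (by positivity)]
    nlinarith
  obtain ⟨D, hD, hDA, hTD⟩ := exists_inverse_abs_add T hε
  have hC : ‖T ∘L D‖ ≤ 1 := opNorm_le_bound _ zero_le_one fun x => by simpa using hTD x
  have hQ' := hsSq_comp_ne_top' (T ∘L D) hQ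
  have key (i : basisIndex E) : (⟪basis E i, CFC.abs T (basis E i)⟫_ℂ).re ≤
      (‖(adjoint Q ∘L (T ∘L D)) (basis E i)‖ ^ 2 + ‖P (basis E i)‖ ^ 2) / 2 + ε := by
    set e := basis E i
    have he : ‖e‖ = 1 := (basis E).orthonormal.1 i
    set a := CFC.abs T e with ha
    have h0 : a = D (CFC.abs T a) + (ε : ℂ) • D a := by
      have := congr($hDA a)
      simpa using this.symm
    have hDs (x y : E) : ⟪x, D y⟫_ℂ = ⟪D x, y⟫_ℂ := by
      rw [← adjoint_inner_left, ← star_eq_adjoint, hD.star_eq]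
    have hAs (x y : E) : ⟪x, CFC.abs T y⟫_ℂ = ⟪CFC.abs T x, y⟫_ℂ := by
      rw [← adjoint_inner_left, ← star_eq_adjoint, (CFC.abs_nonneg T).isSelfAdjoint.star_eq]
    have h1 : ⟪e, a⟫_ℂ = ⟪(adjoint Q ∘L (T ∘L D)) e, P e⟫_ℂ +
        (ε : ℂ) * ⟪CFC.abs T (D e), e⟫_ℂ := by
      conv_lhs => rw [h0]
      rw [inner_add_right, inner_smul_right, hDs, hAs, ha, inner_abs_abs, hDs, hAs]
      congr 1
      exact (adjoint_inner_left Q (P e) (T (D e))).symm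
    rw [h1, Complex.add_re, Complex.re_ofReal_mul]
    refine add_le_add ((Complex.re_le_norm _).trans (norm_inner_le_half _ _)) ?_
    have h2 : (⟪CFC.abs T (D e), e⟫_ℂ).re ≤ 1 := by
      refine (Complex.re_le_norm _).trans ((norm_inner_le_norm _ _).trans ?_)
      rw [norm_abs_apply, he, mul_one, ← he]
      exact hTD e
    nlinarith
  refine (Finset.sum_le_sum fun i _ => key i).trans ?_
  rw [Finset.sum_add_distrib, ← Finset.sum_div, Finset.sum_add_distrib, Finset.sum_const,
    nsmul_eq_mul]
  refine add_le_add ?_ hεδ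
  have h1 := sum_le_hasSum s (fun _ _ => by positivity) (hasSum_hsSq hQ')
  have h2 := sum_le_hasSum s (fun _ _ => by positivity) (hasSum_hsSq hP)
  have h3 := toReal_hsSq_comp_le' (T ∘L D) hQ
  have h4 : ‖T ∘L D‖ ^ 2 * (hsSq (adjoint Q)).toReal ≤ (hsSq (adjoint Q)).toReal :=
    mul_le_of_le_one_left ENNReal.toReal_nonneg (pow_le_one₀ (norm_nonneg _) hC)
  linarith

theorem inner_comp_comp (X : E →L[ℂ] E) (P : E →L[ℂ] G) (Q : G →L[ℂ] E) (x : E) :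
    ⟪x, (X ∘L Q ∘L P) x⟫_ℂ = ⟪(adjoint Q ∘L adjoint X) x, P x⟫_ℂ := by
  simp [adjoint_inner_left]

theorem summable_inner_comp {P : E →L[ℂ] G} {Q : G →L[ℂ] E} (hP : hsSq P ≠ ⊤)
    (hQ : hsSq (adjoint Q) ≠ ⊤) (X : E →L[ℂ] E) :
    Summable fun i : basisIndex E => ⟪basis E i, (X ∘L Q ∘L P) (basis E i)⟫_ℂ := by
  simp_rw [inner_comp_comp]
  have hQ' := hsSq_comp_ne_top' (adjoint X) hQ
  exact .of_norm_bounded (((hasSum_hsSq hQ').add (hasSum_hsSq hP)).div_const 2).summable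
    fun i => norm_inner_le_half _ _

theorem norm_trace_comp_le {P : E →L[ℂ] G} {Q : G →L[ℂ] E} (hP : hsSq P ≠ ⊤)
    (hQ : hsSq (adjoint Q) ≠ ⊤) (X : E →L[ℂ] E) :
    ‖trace (X ∘L Q ∘L P)‖ ≤ (‖X‖ ^ 2 * (hsSq (adjoint Q)).toReal + (hsSq P).toReal) / 2 := by
  have hQ' := hsSq_comp_ne_top' (adjoint X) hQ
  have h1 := ((hasSum_hsSq hQ').add (hasSum_hsSq hP)).div_const 2
  have h2 := toReal_hsSq_comp_le' (adjoint X) hQ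
  rw [LinearIsometryEquiv.norm_map] at h2
  unfold trace
  simp_rw [inner_comp_comp]
  refine (tsum_of_norm_bounded h1 fun i => norm_inner_le_half _ _).trans ?_
  linarith

/-- `X ↦ Tr (X Q P)` is a bounded linear functional if `P` and `Q*` are Hilbert–Schmidt. -/
theorem exists_trace_functional {P : E →L[ℂ] G} {Q : G →L[ℂ] E} (hP : hsSq P ≠ ⊤)
    (hQ : hsSq (adjoint Q) ≠ ⊤) :
    ∃ τ : (E →L[ℂ] E) →L[ℂ] ℂ, ∀ X, τ X = trace (X ∘L Q ∘L P) := by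
  let f : (E →L[ℂ] E) →ₗ[ℂ] ℂ :=
    { toFun X := trace (X ∘L Q ∘L P)
      map_add' X Y := by
        unfold trace
        rw [← (summable_inner_comp hP hQ X).tsum_add (summable_inner_comp hP hQ Y)]
        simp
      map_smul' c X := by
        unfold trace
        simp only [RingHom.id_apply, smul_eq_mul]
        rw [← tsum_mul_left]
        simp }
  refine ⟨f.mkContinuousOfExistsBound ?_, fun X => rfl⟩
  refine ⟨((hsSq (adjoint Q)).toReal + (hsSq P).toReal) / 2, fun X => ?_⟩
  -- The available bound is quadratic in `‖X‖`; used on the unit sphere, it becomes linear by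
  -- homogeneity.
  refine LinearMap.bound_of_sphere_bound zero_lt_one
    (((hsSq (adjoint Q)).toReal + (hsSq P).toReal) / 2) f (fun Y hY => ?_) X |>.trans ?_
  · have := norm_trace_comp_le hP hQ Y
    simp_all [f]
  · simp

/-- Expanding `Y eᵢ` in an orthonormal basis of `N` turns the trace into a finite sum of Parseval
series. -/
theorem trace_eq_linearMap_trace (N : Submodule ℂ E) [FiniteDimensional ℂ N] (Y : E →L[ℂ] E)
    (hY : ∀ x, Y x ∈ N) :
    trace Y = LinearMap.trace ℂ N ((Y : E →ₗ[ℂ] E).restrict (fun x _ => hY x : ∀ x ∈ N, _)) := by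
  set n := stdOrthonormalBasis ℂ N
  rw [LinearMap.trace_eq_sum_inner _ n]
  have h1 (k) : HasSum (fun i : basisIndex E => ⟪adjoint Y (n k), basis E i⟫_ℂ *
      ⟪basis E i, (n k : E)⟫_ℂ) ⟪(n k : E), Y (n k)⟫_ℂ := by
    rw [← adjoint_inner_left]
    exact (basis E).hasSum_inner_mul_inner _ _
  have h2 := hasSum_sum (s := Finset.univ) fun k _ => h1 k
  refine Eq.trans ?_ h2.tsum_eq
  refine tsum_congr fun i => ?_
  have h3 := congr_arg (fun y : N => (y : E)) (n.sum_repr' ⟨Y (basis E i), hY _⟩)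
  simp only [Submodule.coe_sum, Submodule.coe_smul, Submodule.coe_inner] at h3
  conv_lhs => rw [← h3]
  rw [inner_sum]
  refine Finset.sum_congr rfl fun k _ => ?_
  rw [inner_smul_right, adjoint_inner_left]

theorem norm_linearMap_trace_restrict_le {P : E →L[ℂ] G} {Q : G →L[ℂ] E} (hP : hsSq P ≠ ⊤)
    (hQ : hsSq (adjoint Q) ≠ ⊤) (N : Submodule ℂ E) [FiniteDimensional ℂ N]
    (hN : ∀ x ∈ N, ((Q ∘L P : E →L[ℂ] E) : E →ₗ[ℂ] E) x ∈ N) :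
    ‖LinearMap.trace ℂ N (((Q ∘L P : E →L[ℂ] E) : E →ₗ[ℂ] E).restrict hN)‖ ≤
      ((hsSq (adjoint Q)).toReal + (hsSq P).toReal) / 2 := by
  set n := stdOrthonormalBasis ℂ N
  have hn : Orthonormal ℂ fun k => (n k : E) := n.orthonormal.comp_linearIsometry N.subtypeₗᵢ
  rw [LinearMap.trace_eq_sum_inner _ n]
  have h1 := sum_norm_sq_le_hsSq hn hQ
  have h2 := sum_norm_sq_le_hsSq hn hP
  refine (norm_sum_le_of_le _ fun k _ => ?_ : _ ≤ ∑ k, (‖adjoint Q (n k)‖ ^ 2 +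
    ‖P (n k)‖ ^ 2) / 2).trans ?_
  · refine le_trans (le_of_eq ?_) (norm_inner_le_half _ _)
    rw [adjoint_inner_left]
    rfl
  · rw [← Finset.sum_div, Finset.sum_add_distrib]
    linarith

end TraceClass

/-! ### Root spaces and the singularities of `(1 + sA)⁻¹`. -/

section RootSpace

variable {E : Type*} [NormedAddCommGroup E] [InnerProductSpace ℂ E] [CompleteSpace E]
  {G : Type*} [NormedAddCommGroup G] [InnerProductSpace ℂ G] [CompleteSpace G]

/-- Fredholm alternative: `-1/s` is either an eigenvalue of `A` or in its resolvent set. -/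
theorem isUnit_one_add_smul {A : E →L[ℂ] E} (hA : IsCompactOperator A) (s : ℂ)
    (h : ∀ x, x + s • A x = 0 → x = 0) : IsUnit (1 + s • A) := by
  rcases eq_or_ne s 0 with rfl | hs
  · simp
  have hs' : -s⁻¹ ≠ 0 := neg_ne_zero.2 (inv_ne_zero hs)
  rcases hA.hasEigenvalue_or_mem_resolventSet hs' with h1 | h1
  · obtain ⟨x, hx⟩ := h1.exists_hasEigenvector
    refine absurd (h x ?_) hx.2
    have := hx.apply_eq_smul
    rw [coe_coe] at this
    rw [this, smul_smul]
    simp [hs]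
  · rw [spectrum.mem_resolventSet_iff] at h1
    have h2 : (1 : E →L[ℂ] E) + s • A =
        Units.mk0 (-s) (neg_ne_zero.2 hs) • (algebraMap ℂ (E →L[ℂ] E) (-s⁻¹) - A) := by
      rw [Units.smul_mk0, smul_sub, Algebra.algebraMap_eq_smul_one, smul_smul]
      simp [hs]
    rw [h2]
    exact h1.smul _

/-- `A - μ` maps level `k + 1` into level `k`, with kernel inside the finite-dimensional eigenspace.
-/
theorem finiteDimensional_genEigenspace {A : E →L[ℂ] E} (hA : IsCompactOperator A) {μ : ℂ}
    (hμ : μ ≠ 0) (k : ℕ) :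
    FiniteDimensional ℂ (Module.End.genEigenspace (A : E →ₗ[ℂ] E) μ k) := by
  induction k with
  | zero =>
    have : Module.End.genEigenspace (A : E →ₗ[ℂ] E) μ (0 : ℕ) = ⊥ := by simp
    rw [this]
    infer_instance
  | succ k ih =>
    have h1 := A.finite_dimensional_eigenspace hA μ hμ
    rw [← Submodule.fg_iff_finiteDimensional] at ih h1 ⊢
    refine Submodule.fg_of_fg_map_of_fg_inf_ker ((A : E →ₗ[ℂ] E) - μ • 1) ?_ ?_
    · refine Submodule.FG.of_le ih ?_
      rintro _ ⟨x, hx, rfl⟩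
      rw [SetLike.mem_coe, Module.End.mem_genEigenspace_nat] at hx
      rw [Module.End.mem_genEigenspace_nat]
      rwa [LinearMap.mem_ker, pow_succ] at hx
    · refine Submodule.FG.of_le h1 fun x hx => ?_
      rw [Module.End.eigenspace_def]
      exact hx.2

theorem linearMap_trace_eq_of_isNilpotent_sub {N : Type*} [AddCommGroup N] [Module ℂ N]
    [FiniteDimensional ℂ N] {f : N →ₗ[ℂ] N} {c : ℂ} (h : IsNilpotent (f - c • 1)) :
    LinearMap.trace ℂ N f = c * Module.finrank ℂ N := by
  have h1 := (LinearMap.isNilpotent_trace_of_isNilpotent h).eq_zero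
  rw [map_sub, map_smul, LinearMap.trace_one, sub_eq_zero] at h1
  simpa using h1

/-- On this space `A = QP` has trace `μ` times the dimension. The bound does not depend on `k`, so
the increasing chain of generalized eigenspaces must stabilize. -/
theorem finrank_genEigenspace_le {P : E →L[ℂ] G} {Q : G →L[ℂ] E} (hP : hsSq P ≠ ⊤)
    (hQ : hsSq (adjoint Q) ≠ ⊤) {μ : ℂ} (hμ : μ ≠ 0) (k : ℕ) :
    ‖μ‖ * Module.finrank ℂ
      (Module.End.genEigenspace ((Q ∘L P : E →L[ℂ] E) : E →ₗ[ℂ] E) μ k) ≤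
      ((hsSq (adjoint Q)).toReal + (hsSq P).toReal) / 2 := by
  have hA : IsCompactOperator (Q ∘L P) := (isCompactOperator_of_hsSq_ne_top hP).clm_comp Q
  have := finiteDimensional_genEigenspace hA hμ k
  have h1 := norm_linearMap_trace_restrict_le hP hQ _
    (Module.End.mapsTo_genEigenspace_of_comm (Commute.refl _) μ k)
  rw [linearMap_trace_eq_of_isNilpotent_sub (c := μ)] at h1
  · simpa using h1
  · exact Module.End.isNilpotent_restrict_genEigenspace_nat _ μ k

theorem finiteDimensional_rootSpace {P : E →L[ℂ] G} {Q : G →L[ℂ] E} (hP : hsSq P ≠ ⊤)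
    (hQ : hsSq (adjoint Q) ≠ ⊤) {μ : ℂ} (hμ : μ ≠ 0) :
    FiniteDimensional ℂ (rootSpace (Q ∘L P) μ) := by
  have hA : IsCompactOperator (Q ∘L P) := (isCompactOperator_of_hsSq_ne_top hP).clm_comp Q
  set f : Module.End ℂ E := ((Q ∘L P : E →L[ℂ] E) : E →ₗ[ℂ] E) with hf
  have hfin (k : ℕ) := finiteDimensional_genEigenspace hA hμ k
  rw [← hf] at hfin
  obtain ⟨M, hM⟩ : ∃ M : ℕ, ∀ k : ℕ, Module.finrank ℂ (f.genEigenspace μ k) ≤ M := by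
    refine ⟨⌈((hsSq (adjoint Q)).toReal + (hsSq P).toReal) / 2 / ‖μ‖⌉₊, fun k => ?_⟩
    have h1 := finrank_genEigenspace_le hP hQ hμ k
    rw [← Nat.cast_le (α := ℝ)]
    refine le_trans ?_ (Nat.le_ceil _)
    rwa [le_div_iff₀' (norm_pos_iff.2 hμ)]
  obtain ⟨k₀, hk₀⟩ : ∃ k₀ : ℕ, ∀ k : ℕ, Module.finrank ℂ (f.genEigenspace μ k) ≤
      Module.finrank ℂ (f.genEigenspace μ k₀) := by
    have hb : BddAbove (Set.range fun k : ℕ => Module.finrank ℂ (f.genEigenspace μ k)) :=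
      ⟨M, by rintro _ ⟨k, rfl⟩; exact hM k⟩
    obtain ⟨k₀, hk₀⟩ := Nat.sSup_mem (Set.range_nonempty _) hb
    exact ⟨k₀, fun k => (le_csSup hb ⟨k, rfl⟩).trans hk₀.ge⟩
  have hle : rootSpace (Q ∘L P) μ ≤ f.genEigenspace μ k₀ := by
    intro x hx
    obtain ⟨k, hk⟩ := (Module.End.mem_maxGenEigenspace _ _ _).1 hx
    have h1 : f.genEigenspace μ k₀ ≤ f.genEigenspace μ (max k k₀ : ℕ) :=
      (f.genEigenspace μ).monotone (by simp)
    have h2 : f.genEigenspace μ k ≤ f.genEigenspace μ (max k k₀ : ℕ) :=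
      (f.genEigenspace μ).monotone (by simp)
    have := hfin (max k k₀)
    rw [Submodule.eq_of_le_of_finrank_le h1 (hk₀ _)]
    exact h2 (Module.End.mem_genEigenspace_nat.2 hk)
  exact Submodule.finiteDimensional_of_le hle

/-- The operator `(1 + s A)⁻¹` (and `0` if the inverse does not exist). -/
def invOneAdd (A : E →L[ℂ] E) (s : ℂ) : E →L[ℂ] E := Ring.inverse (1 + s • A)

theorem analyticAt_invOneAdd {A : E →L[ℂ] E} {s : ℂ} (h : IsUnit (1 + s • A)) :
    AnalyticAt ℂ (invOneAdd A) s := by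
  obtain ⟨u, hu⟩ := h
  have h1 : AnalyticAt ℂ Ring.inverse (1 + s • A) := by rw [← hu]; exact analyticAt_inverse u
  exact h1.comp (f := fun s : ℂ => 1 + s • A) (by fun_prop)

theorem invOneAdd_mul {A : E →L[ℂ] E} {s : ℂ} (h : IsUnit (1 + s • A)) :
    invOneAdd A s * (1 + s • A) = 1 := Ring.inverse_mul_cancel _ h

theorem mul_invOneAdd {A : E →L[ℂ] E} {s : ℂ} (h : IsUnit (1 + s • A)) :
    (1 + s • A) * invOneAdd A s = 1 := Ring.mul_inverse_cancel _ h

theorem commute_invOneAdd (A : E →L[ℂ] E) (s : ℂ) : Commute A (invOneAdd A s) := by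
  have : Commute A (1 + s • A) := (Commute.one_right A).add_right ((Commute.refl A).smul_right s)
  by_cases h : IsUnit (1 + s • A)
  · obtain ⟨u, hu⟩ := h
    rw [invOneAdd, ← hu, Ring.inverse_unit]
    rw [← hu] at this
    exact this.units_inv_right
  · rw [invOneAdd, Ring.inverse_non_unit _ h]
    exact Commute.zero_right A

theorem eventually_isUnit {A : E →L[ℂ] E} {s : ℂ} (h : IsUnit (1 + s • A)) :
    ∀ᶠ t in 𝓝 s, IsUnit (1 + t • A) := by
  have : ContinuousAt (fun t : ℂ => 1 + t • A) s := by fun_prop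
  exact this.eventually (Units.isOpen.mem_nhds h)

variable (A : E →L[ℂ] E) (μ : ℂ) [FiniteDimensional ℂ (rootSpace A μ)]

/-- The orthogonal projection onto the complement of the root space. -/
def coProj : E →L[ℂ] E := 1 - (rootSpace A μ).starProjection

theorem coProj_apply_eq_zero {x : E} : coProj A μ x = 0 ↔ x ∈ rootSpace A μ := by
  change x - _ = 0 ↔ _
  rw [sub_eq_zero, eq_comm]
  exact Submodule.starProjection_eq_self_iff

theorem sub_coProj_mem (x : E) : x - coProj A μ x ∈ rootSpace A μ := by
  simp [coProj]

/-- The orthogonal projection need not commute with `Y`; invariance of the root space gives only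
this one-sided relation, and it suffices. -/
theorem coProj_mul_eq {Y : E →L[ℂ] E} (hY : ∀ x ∈ rootSpace A μ, Y x ∈ rootSpace A μ) :
    coProj A μ * Y = coProj A μ * Y * coProj A μ := by
  ext x
  have := (coProj_apply_eq_zero A μ).2 (hY _ (sub_coProj_mem A μ x))
  rw [map_sub, map_sub, sub_eq_zero] at this
  exact this

theorem mapsTo_rootSpace_of_commute {Y : E →L[ℂ] E} (h : Commute A Y) :
    ∀ x ∈ rootSpace A μ, Y x ∈ rootSpace A μ := by
  have h1 : Commute (A : Module.End ℂ E) (Y : Module.End ℂ E) := by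
    ext x; exact congr($h.eq x)
  exact Module.End.mapsTo_maxGenEigenspace_of_comm h1 μ

theorem mem_rootSpace_of_sub_smul_mem {x : E} (h : A x - μ • x ∈ rootSpace A μ) :
    x ∈ rootSpace A μ := by
  obtain ⟨k, hk⟩ := (Module.End.mem_maxGenEigenspace _ _ _).1 h
  refine (Module.End.mem_maxGenEigenspace _ _ _).2 ⟨k + 1, ?_⟩
  rw [pow_succ]
  exact hk

variable {A μ}

/-- A null vector `x` satisfies `px = x` and `p(A + s⁻¹)x = 0`. Then `(A + s⁻¹)x` lies in the root
space, hence so does `x`, and `x = px = 0`. -/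
theorem isUnit_one_add_smul_coProj_mul (hA : IsCompactOperator A) {s : ℂ} (hs : s ≠ 0)
    [FiniteDimensional ℂ (rootSpace A (-s⁻¹))] :
    IsUnit (1 + s • (coProj A (-s⁻¹) * A)) := by
  refine isUnit_one_add_smul (A := coProj A (-s⁻¹) * A) (hA.clm_comp (coProj A (-s⁻¹))) s
    fun x hx => ?_
  change x + s • coProj A (-s⁻¹) (A x) = 0 at hx
  set p := coProj A (-s⁻¹) with hp
  have hpp : p x = x := by
    have h0 : p (p (A x)) = p (A x) := by
      have := (coProj_apply_eq_zero A (-s⁻¹)).2 (sub_coProj_mem A (-s⁻¹) (A x))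
      rw [map_sub, sub_eq_zero] at this
      exact this.symm
    rw [eq_neg_of_add_eq_zero_left hx, map_neg, map_smul, h0]
  have h1 : p (A x - (-s⁻¹) • x) = 0 := by
    rw [map_sub, map_smul, hpp, ← smul_right_injective E hs |>.eq_iff]
    simp only [smul_sub, smul_smul, smul_zero]
    rw [mul_neg, mul_inv_cancel₀ hs, neg_one_smul, sub_neg_eq_add, add_comm]
    exact hx
  have h2 := mem_rootSpace_of_sub_smul_mem A _ ((coProj_apply_eq_zero _ _).1 h1)
  rw [← hpp, hp, coProj_apply_eq_zero]
  exact h2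

theorem coProj_mul_invOneAdd {s : ℂ} (h : IsUnit (1 + s • A))
    (h' : IsUnit (1 + s • (coProj A μ * A))) :
    coProj A μ * invOneAdd A s = invOneAdd (coProj A μ * A) s * coProj A μ := by
  have h1 : (1 + s • (coProj A μ * A)) * (coProj A μ * invOneAdd A s) = coProj A μ := by
    have h2 := coProj_mul_eq A μ (mapsTo_rootSpace_of_commute A μ (Commute.refl A))
    calc _ = coProj A μ * invOneAdd A s + s • (coProj A μ * A * coProj A μ) * invOneAdd A s := by
          simp only [add_mul, one_mul, smul_mul_assoc, mul_assoc]
      _ = coProj A μ * ((1 + s • A) * invOneAdd A s) := by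
          rw [← h2]
          simp only [add_mul, one_mul, smul_mul_assoc, mul_assoc, mul_add, mul_smul_comm]
      _ = _ := by rw [mul_invOneAdd h, mul_one]
  have h2 := congr(invOneAdd (coProj A μ * A) s * $h1)
  rwa [← mul_assoc, invOneAdd_mul h', one_mul] at h2

/-- If `(1 + sA)x = 0`, then `1 + s pA` kills `px`, so `x` lies in the root space for `-1/s₀`. That
space contains no eigenvector for the different number `-1/s`. -/
theorem eventually_isUnit_one_add_smul (hA : IsCompactOperator A) {s₀ : ℂ} (hs : s₀ ≠ 0)
    [FiniteDimensional ℂ (rootSpace A (-s₀⁻¹))] :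
    ∀ᶠ s in 𝓝[≠] s₀, IsUnit (1 + s • A) := by
  filter_upwards [(eventually_isUnit (isUnit_one_add_smul_coProj_mul hA hs)).filter_mono
    nhdsWithin_le_nhds, (eventually_ne_nhds hs).filter_mono nhdsWithin_le_nhds,
    self_mem_nhdsWithin] with s h1 h2 h3
  refine isUnit_one_add_smul hA s fun x hx => ?_
  have hev : A x = (-s⁻¹) • x := by
    rw [← smul_right_injective E h2 |>.eq_iff]
    simp only [smul_smul, mul_neg, mul_inv_cancel₀ h2, neg_one_smul]
    exact eq_neg_of_add_eq_zero_right hx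
  set p := coProj A (-s₀⁻¹) with hp
  have hinv := coProj_mul_eq A (-s₀⁻¹) (mapsTo_rootSpace_of_commute A _ (Commute.refl A))
  have h4 : (1 + s • (p * A)) (p x) = 0 := by
    have h5 : p (A (p x)) = p (A x) := congr($hinv x).symm
    change p x + s • p (A (p x)) = 0
    rw [h5, ← map_smul, ← map_add, hx, map_zero]
  have h5 : p x = 0 := by
    have := congr($(invOneAdd_mul h1) (p x))
    change invOneAdd (p * A) s ((1 + s • (p * A)) (p x)) = p x at this
    rw [← this, h4, map_zero]
  have h6 : x ∈ rootSpace A (-s₀⁻¹) := (coProj_apply_eq_zero _ _).1 h5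
  have h7 : x ∈ Module.End.genEigenspace (A : E →ₗ[ℂ] E) (-s⁻¹) 1 := by
    rw [Module.End.mem_genEigenspace_one]; exact hev
  have hne : -s₀⁻¹ ≠ -s⁻¹ := fun h => h3 (inv_injective (neg_injective h)).symm
  exact (Submodule.disjoint_def.1 (Module.End.disjoint_genEigenspace _ hne ⊤ 1)) x h6 h7

theorem trace_starProjection_mul {s₀ s : ℂ} (hs₀ : s₀ ≠ 0) (hs : s ≠ s₀)
    [FiniteDimensional ℂ (rootSpace A (-s₀⁻¹))] (h : IsUnit (1 + s • A)) :
    trace ((rootSpace A (-s₀⁻¹)).starProjection * invOneAdd A s * A) =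
      (s - s₀)⁻¹ * Module.finrank ℂ (rootSpace A (-s₀⁻¹)) := by
  set N := rootSpace A (-s₀⁻¹) with hN
  set c := (s - s₀)⁻¹ with hc
  have hsub : s - s₀ ≠ 0 := sub_ne_zero.2 hs
  have hY (x : E) : (N.starProjection * invOneAdd A s * A) x ∈ N :=
    N.starProjection_apply_mem _
  rw [trace_eq_linearMap_trace N _ hY]
  apply linearMap_trace_eq_of_isNilpotent_sub
  have hX := mapsTo_rootSpace_of_commute A (-s₀⁻¹) (commute_invOneAdd A s)
  have hT : ∀ x ∈ N, ((A : Module.End ℂ E) - algebraMap ℂ (Module.End ℂ E) (-s₀⁻¹)) x ∈ N :=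
    Module.End.mapsTo_maxGenEigenspace_of_comm (Algebra.mul_sub_algebraMap_commutes _ _) _
  have hnil : IsNilpotent
      (((A : Module.End ℂ E) - algebraMap ℂ (Module.End ℂ E) (-s₀⁻¹)).restrict hT) := by
    refine Module.End.isNilpotent_iff_of_finite.2 fun x => ?_
    obtain ⟨k, hk⟩ := (Module.End.mem_maxGenEigenspace _ _ _).1 x.2
    refine ⟨k, ?_⟩
    ext
    rw [Module.End.pow_restrict]
    exact hk
  have hcomm : Commute (LinearMap.restrict (invOneAdd A s : E →ₗ[ℂ] E) hX)
      (((A : Module.End ℂ E) - algebraMap ℂ (Module.End ℂ E) (-s₀⁻¹)).restrict hT) := by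
    ext x
    have := congr($((commute_invOneAdd A s).eq) (x : E))
    change A (invOneAdd A s x) = invOneAdd A s (A x) at this
    change invOneAdd A s (A x - (-s₀⁻¹) • (x : E)) =
      A (invOneAdd A s x) - (-s₀⁻¹) • (invOneAdd A s x)
    rw [this, map_sub, map_smul]
  -- With `c = (s - s₀)⁻¹`, `(1 + sA)⁻¹A - c = -s₀c (1 + sA)⁻¹(A + s₀⁻¹)`, because `1 - cs = -s₀c`;
  -- the right side is nilpotent on `N`.
  have hn := (hcomm.isNilpotent_mul_left hnil).smul (-s₀ * c)
  refine Eq.mp (congrArg IsNilpotent (LinearMap.ext fun x => Subtype.ext (Eq.symm ?_))) hn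
  have h1 : invOneAdd A s (A x) ∈ N :=
    hX _ (mapsTo_rootSpace_of_commute A (-s₀⁻¹) (Commute.refl A) _ x.2)
  have h2 := congr($(invOneAdd_mul h) (x : E))
  change invOneAdd A s ((x : E) + s • A x) = x at h2
  change N.starProjection (invOneAdd A s (A x)) - c • (x : E) =
    (-s₀ * c) • invOneAdd A s (A x - (-s₀⁻¹) • (x : E))
  rw [Submodule.starProjection_eq_self_iff.2 h1]
  rw [map_add, map_smul] at h2
  rw [map_sub, map_smul]
  have e1 : (-s₀ * c) * (-s₀⁻¹) = c := by field_simp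
  have e2 : 1 - c * s = -s₀ * c := by rw [hc]; field_simp; ring
  rw [smul_sub, smul_smul, e1, ← e2]
  linear_combination (norm := module) c • h2

/-- Near any `s₀ ≠ 0`, the function `s ↦ Tr ((1 + s A)⁻¹ A)` has at most a simple pole, with
residue the dimension of the root space of `A` for `-1/s₀`. -/
theorem exists_analyticAt_trace_eq (R : E →L[ℂ] E) {P : E →L[ℂ] G} {Q : G →L[ℂ] E}
    (hP : hsSq P ≠ ⊤) (hQ : hsSq (adjoint Q) ≠ ⊤) {s₀ : ℂ} (hs₀ : s₀ ≠ 0) :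
    ∃ h : ℂ → ℂ, AnalyticAt ℂ h s₀ ∧ ∀ᶠ s in 𝓝[≠] s₀,
      trace (invOneAdd (R ∘L Q ∘L P) s ∘L R ∘L Q ∘L P) =
        (s - s₀)⁻¹ * Module.finrank ℂ (rootSpace (R ∘L Q ∘L P) (-s₀⁻¹)) + h s := by
  obtain ⟨τ, hτ⟩ := exists_trace_functional hP hQ
  have hQ' : hsSq (adjoint (R ∘L Q)) ≠ ⊤ := by
    rw [adjoint_comp]; exact hsSq_comp_ne_top' _ hQ
  set A := R ∘L Q ∘L P with hA
  have hμ : -s₀⁻¹ ≠ 0 := neg_ne_zero.2 (inv_ne_zero hs₀)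
  have hfd : FiniteDimensional ℂ (rootSpace A (-s₀⁻¹)) := finiteDimensional_rootSpace hP hQ' hμ
  have hAc : IsCompactOperator A := (isCompactOperator_of_hsSq_ne_top hP).clm_comp (R ∘L Q)
  set p := coProj A (-s₀⁻¹) with hp
  have hu := isUnit_one_add_smul_coProj_mul hAc hs₀
  -- Off `s₀` this is the trace of `p(1 + sA)⁻¹A`, rewritten in a form that is regular at `s₀`.
  refine ⟨fun s => τ (invOneAdd (p * A) s * (p * R)), ?_, ?_⟩
  · exact τ.analyticAt _ |>.comp ((analyticAt_invOneAdd hu).mul analyticAt_const)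
  filter_upwards [(eventually_isUnit hu).filter_mono nhdsWithin_le_nhds,
    eventually_isUnit_one_add_smul hAc hs₀, self_mem_nhdsWithin] with s h1 h2 h3
  rw [← trace_starProjection_mul hs₀ h3 h2, ← mul_assoc, ← coProj_mul_invOneAdd h2 h1]
  have e1 : (rootSpace A (-s₀⁻¹)).starProjection * invOneAdd A s * A =
    ((rootSpace A (-s₀⁻¹)).starProjection * invOneAdd A s * R) ∘L Q ∘L P := rfl
  have e2 : invOneAdd A s ∘L A = (invOneAdd A s * R) ∘L Q ∘L P := rfl
  change trace (invOneAdd A s ∘L A) = _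
  rw [e1, e2, ← hτ, ← hτ, ← map_add]
  congr 1
  rw [← hp, hp, coProj]
  simp only [sub_mul, one_mul]
  abel

theorem analyticAt_trace (R : E →L[ℂ] E) {P : E →L[ℂ] G} {Q : G →L[ℂ] E}
    (hP : hsSq P ≠ ⊤) (hQ : hsSq (adjoint Q) ≠ ⊤) {s₀ : ℂ}
    (h : IsUnit (1 + s₀ • (R ∘L Q ∘L P))) :
    AnalyticAt ℂ (fun s => trace (invOneAdd (R ∘L Q ∘L P) s ∘L R ∘L Q ∘L P)) s₀ := by
  obtain ⟨τ, hτ⟩ := exists_trace_functional hP hQ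
  have h1 : (fun s => trace (invOneAdd (R ∘L Q ∘L P) s ∘L R ∘L Q ∘L P)) =
      fun s => τ (invOneAdd (R ∘L Q ∘L P) s * R) := by
    ext s
    rw [hτ]
    rfl
  rw [h1]
  exact τ.analyticAt _ |>.comp ((analyticAt_invOneAdd h).mul analyticAt_const)

end RootSpace

/-! ### Resolvents of `H₀` and of `H_s`. -/

section SelfAdjoint

variable {E : Type*} [NormedAddCommGroup E] [InnerProductSpace ℂ E]

theorem resolventOp_eq {T : E →ₗ.[ℂ] E} {z : ℂ} {R : E →L[ℂ] E} (h : IsResolventAt T z R) :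
    resolventOp T z = R := by
  have hex : ∃ R : E →L[ℂ] E, IsResolventAt T z R := ⟨R, h⟩
  rw [resolventOp, dif_pos hex]
  exact hex.choose_spec.unique h

theorem inner_im_eq_zero {T : E →ₗ.[ℂ] E} (hT : T.IsFormalAdjoint T) (x : T.domain) :
    (⟪(x : E), T x⟫_ℂ).im = 0 := by
  have := hT x x
  rw [← inner_conj_symm] at this
  exact Complex.conj_eq_iff_im.1 this

theorem norm_le_of_isFormalAdjoint {T : E →ₗ.[ℂ] E} (hT : T.IsFormalAdjoint T) (z : ℂ)
    (x : T.domain) : |z.im| * ‖(x : E)‖ ≤ ‖T x - z • (x : E)‖ := by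
  have h1 : (⟪(x : E), T x - z • (x : E)⟫_ℂ).im = -z.im * ‖(x : E)‖ ^ 2 := by
    rw [inner_sub_right, inner_smul_right, Complex.sub_im, inner_im_eq_zero hT,
      inner_self_eq_norm_sq_to_K]
    simp [← Complex.ofReal_pow]
  have h2 : |z.im| * ‖(x : E)‖ ^ 2 ≤ ‖(x : E)‖ * ‖T x - z • (x : E)‖ := by
    refine le_trans (le_of_eq ?_) ((Complex.abs_im_le_norm _).trans (norm_inner_le_norm _ _))
    rw [h1, abs_mul, abs_neg, abs_of_nonneg (sq_nonneg ‖(x : E)‖)]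
  rcases (norm_nonneg (x : E)).eq_or_lt with h | h
  · rw [← h, mul_zero]; exact norm_nonneg _
  · refine le_of_mul_le_mul_left ?_ h
    linarith

theorem eq_zero_of_isFormalAdjoint {T : E →ₗ.[ℂ] E} (hT : T.IsFormalAdjoint T) {z : ℂ}
    (hz : z.im ≠ 0) (x : T.domain) (hx : T x = z • (x : E)) : (x : E) = 0 := by
  have h := norm_le_of_isFormalAdjoint hT z x
  rw [hx, sub_self, norm_zero] at h
  exact norm_le_zero_iff.1 (nonpos_of_mul_nonpos_right h (abs_pos.2 hz))

variable [CompleteSpace E]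

theorem isFormalAdjoint_of_isSelfAdjoint {T : E →ₗ.[ℂ] E} (hT : IsSelfAdjoint T) :
    T.IsFormalAdjoint T := by
  have := LinearPMap.adjoint_isFormalAdjoint hT.dense_domain
  rwa [LinearPMap.isSelfAdjoint_def.1 hT] at this

theorem adjoint_eq_of_isResolventAt {T : E →ₗ.[ℂ] E} (hT : T.IsFormalAdjoint T) {z : ℂ}
    {R R' : E →L[ℂ] E} (h : IsResolventAt T z R) (h' : IsResolventAt T (starRingEnd ℂ z) R') :
    adjoint R = R' := by
  rw [eq_comm, eq_adjoint_iff]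
  intro x y
  obtain ⟨hx, ex⟩ := h'.1 x
  obtain ⟨hy, ey⟩ := h.1 y
  have h1 := hT ⟨R' x, hx⟩ ⟨R y, hy⟩
  conv_lhs => rw [← ey]
  conv_rhs => rw [← ex]
  rw [inner_sub_right, inner_sub_left, inner_smul_right, inner_smul_left, Complex.conj_conj, h1]

theorem exists_isResolventAt {T : E →ₗ.[ℂ] E} (hT : IsSelfAdjoint T) {z : ℂ} (hz : z.im ≠ 0) :
    ∃ R : E →L[ℂ] E, IsResolventAt T z R := by
  have hsym := isFormalAdjoint_of_isSelfAdjoint hT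
  let S : T.domain →ₗ[ℂ] E := T.toFun - z • T.domain.subtype
  have hS (x : T.domain) : S x = T x - z • (x : E) := rfl
  have hz' : 0 < |z.im| := abs_pos.2 hz
  have hbound (x : T.domain) : |z.im| * ‖(x : E)‖ ≤ ‖S x‖ := norm_le_of_isFormalAdjoint hsym z x
  have hinj : Function.Injective S := by
    rw [← LinearMap.ker_eq_bot, LinearMap.ker_eq_bot']
    intro x hx
    exact Subtype.ext (eq_zero_of_isFormalAdjoint hsym hz x (sub_eq_zero.1 hx))
  -- The lower bound makes preimages of a convergent sequence Cauchy, and the graph of `T` is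
  -- closed.
  have hclosed : IsClosed (S.range : Set E) := by
    refine IsSeqClosed.isClosed fun u y hu hy => ?_
    choose x hx using hu
    have hc : CauchySeq fun n => (x n : E) := by
      have hcu := hy.cauchySeq
      rw [Metric.cauchySeq_iff'] at hcu ⊢
      intro ε hε
      obtain ⟨n, hn⟩ := hcu (|z.im| * ε) (by positivity)
      refine ⟨n, fun m hm => ?_⟩
      have h1 := hbound (x m - x n)
      rw [map_sub, hx, hx, ← dist_eq_norm_sub, Submodule.coe_sub, ← dist_eq_norm_sub] at h1
      exact lt_of_mul_lt_mul_left (h1.trans_lt (hn m hm)) hz'.le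
    obtain ⟨x₀, hx₀⟩ := cauchySeq_tendsto_of_complete hc
    have hTx : Tendsto (fun n => T (x n)) atTop (𝓝 (y + z • x₀)) := by
      have := hy.add (hx₀.const_smul z)
      refine this.congr fun n => ?_
      rw [← hx, hS, sub_add_cancel]
    have hg : (x₀, y + z • x₀) ∈ T.graph :=
      hT.isClosed.mem_of_tendsto (hx₀.prodMk_nhds hTx)
        (Eventually.of_forall fun n => T.mem_graph (x n))
    obtain ⟨w, hw1, hw2⟩ := T.mem_graph_iff.1 hg
    refine ⟨w, ?_⟩
    rw [hS, hw2, hw1]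
    simp
  -- A vector orthogonal to the range is an eigenvector of the adjoint, hence of `T`, for the
  -- non-real `z̄`, unless it is zero.
  have hrange : S.range = ⊤ := by
    have : CompleteSpace S.range := hclosed.completeSpace_coe
    rw [← Submodule.orthogonal_eq_bot_iff, Submodule.eq_bot_iff]
    intro y hy
    rw [Submodule.mem_orthogonal'] at hy
    have h1 (x : T.domain) : ⟪(starRingEnd ℂ z) • y, (x : E)⟫_ℂ = ⟪y, T x⟫_ℂ := by
      have := hy _ ⟨x, rfl⟩
      rw [hS, inner_sub_right, inner_smul_right, sub_eq_zero] at this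
      rw [inner_smul_left, Complex.conj_conj, this]
    have h2 := LinearPMap.mem_adjoint_domain_of_exists y ⟨_, h1⟩
    have h3 := LinearPMap.adjoint_apply_eq hT.dense_domain ⟨y, h2⟩ h1
    have h4 : (y, (starRingEnd ℂ z) • y) ∈ T.adjoint.graph := by
      rw [← h3]; exact T.adjoint.mem_graph ⟨y, h2⟩
    rw [LinearPMap.isSelfAdjoint_def.1 hT] at h4
    obtain ⟨w, hw1, hw2⟩ := T.mem_graph_iff.1 h4
    change (w : E) = y at hw1
    rw [← hw1]
    refine eq_zero_of_isFormalAdjoint hsym (z := starRingEnd ℂ z) (by simpa using hz) w ?_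
    rw [hw1, hw2]
  let e := LinearEquiv.ofBijective S ⟨hinj, LinearMap.range_eq_top.1 hrange⟩
  have he (x : E) : S (e.symm x) = x := e.apply_symm_apply x
  let R : E →L[ℂ] E := (T.domain.subtype ∘ₗ e.symm.toLinearMap).mkContinuous |z.im|⁻¹ fun x => by
    have := hbound (e.symm x)
    rw [he] at this
    rwa [inv_mul_eq_div, le_div_iff₀' hz']
  refine ⟨R, fun x => ⟨(e.symm x).2, he x⟩, fun y => ?_⟩
  exact congr_arg Subtype.val (e.symm_apply_apply y)

theorem isFormalAdjoint_path {H₀ : E →ₗ.[ℂ] E} (hH : H₀.IsFormalAdjoint H₀) {V : E →L[ℂ] E}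
    (hV : IsSelfAdjoint V) (s : ℝ) : (path H₀ V s).IsFormalAdjoint (path H₀ V s) := by
  intro x y
  have h1 := hH x y
  have h2 : ⟪V (x : E), (y : E)⟫_ℂ = ⟪(x : E), V (y : E)⟫_ℂ := by
    rw [← adjoint_inner_right, ← star_eq_adjoint, hV.star_eq]
  change ⟪(s : ℂ) • V (x : E) + H₀ x, (y : E)⟫_ℂ = ⟪(x : E), (s : ℂ) • V (y : E) + H₀ y⟫_ℂ
  rw [inner_add_left, inner_add_right, inner_smul_left, inner_smul_right, h1, h2,
    Complex.conj_ofReal]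

variable {H₀ : E →ₗ.[ℂ] E} {V R : E →L[ℂ] E} {z : ℂ}

/-- A null vector lies in the domain of `H₀` and satisfies `H_s x = z x`, impossible for symmetric
`H_s` and non-real `z` unless `x = 0`. -/
theorem isUnit_one_add_real_smul (hH : H₀.IsFormalAdjoint H₀) (hV : IsSelfAdjoint V)
    (hz : z.im ≠ 0) (hR : IsResolventAt H₀ z R) (hc : IsCompactOperator (R ∘L V)) (s : ℝ) :
    IsUnit (1 + (s : ℂ) • (R ∘L V)) := by
  refine isUnit_one_add_smul hc s fun x hx => ?_
  have hx' : x = R (-((s : ℂ) • V x)) := by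
    rw [map_neg, map_smul]
    exact eq_neg_of_add_eq_zero_left hx
  obtain ⟨h, e⟩ := hR.1 (-((s : ℂ) • V x))
  have hmem : x ∈ H₀.domain := by rw [hx']; exact h
  refine eq_zero_of_isFormalAdjoint (isFormalAdjoint_path hH hV s) hz ⟨x, hmem⟩ ?_
  have e' : H₀ ⟨x, hmem⟩ - z • x = -((s : ℂ) • V x) := by
    have hsub : (⟨x, hmem⟩ : H₀.domain) = ⟨_, h⟩ := Subtype.ext hx'
    rw [hsub, congr_arg (z • ·) hx']
    exact e
  change (s : ℂ) • V x + H₀ ⟨x, hmem⟩ = z • x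
  rw [sub_eq_iff_eq_add.1 e']
  abel

theorem isResolventAt_path (hR : IsResolventAt H₀ z R) {s : ℝ}
    (hu : IsUnit (1 + (s : ℂ) • (R ∘L V))) :
    IsResolventAt (path H₀ V s) z (invOneAdd (R ∘L V) s ∘L R) := by
  set X := invOneAdd (R ∘L V) (s : ℂ) with hX
  refine ⟨fun x => ?_, fun y => ?_⟩
  · have h1 : X (R x) = R (x - (s : ℂ) • V (X (R x))) := by
      have := congr($(mul_invOneAdd hu) (R x))
      change X (R x) + (s : ℂ) • R (V (X (R x))) = R x at this
      rw [map_sub, map_smul, eq_sub_iff_add_eq]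
      exact this
    obtain ⟨h, e⟩ := hR.1 (x - (s : ℂ) • V (X (R x)))
    have hmem : X (R x) ∈ H₀.domain := by rw [h1]; exact h
    have e' : H₀ ⟨X (R x), hmem⟩ - z • X (R x) = x - (s : ℂ) • V (X (R x)) := by
      have hsub : (⟨X (R x), hmem⟩ : H₀.domain) = ⟨_, h⟩ := Subtype.ext h1
      rw [hsub, congr_arg (z • ·) h1]
      exact e
    refine ⟨hmem, ?_⟩
    change (s : ℂ) • V (X (R x)) + H₀ ⟨X (R x), hmem⟩ - z • X (R x) = x
    rw [add_sub_assoc, e']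
    abel
  · have h1 := hR.2 y
    change X (R ((s : ℂ) • V (y : E) + H₀ y - z • (y : E))) = y
    rw [add_sub_assoc, map_add, h1, map_smul, add_comm]
    exact congr($(invOneAdd_mul hu) (y : E))

end SelfAdjoint

/-! ### Uniqueness of the continuation and residues. -/

section Meromorphic

/-- Two meromorphic functions on the plane that agree on the real line agree near every point,
except possibly at the point itself. -/
theorem eventuallyEq_of_eq_on_real {f g : ℂ → ℂ} (hf : Meromorphic f) (hg : Meromorphic g)
    (h : ∀ s : ℝ, f s = g s) (s₀ : ℂ) : f =ᶠ[𝓝[≠] s₀] g := by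
  have hd : Meromorphic (f - g) := fun x => (hf x).sub (hg x)
  have h0 : meromorphicOrderAt (f - g) 0 = ⊤ := by
    rw [meromorphicOrderAt_eq_top_iff]
    refine (hd 0).frequently_zero_iff_eventuallyEq_zero.1 ?_
    have ht : Tendsto (fun x : ℝ => (x : ℂ)) (𝓝[≠] 0) (𝓝[≠] 0) := by
      refine tendsto_nhdsWithin_iff.2 ⟨?_, ?_⟩
      · exact (Complex.continuous_ofReal.tendsto' 0 0 rfl).mono_left nhdsWithin_le_nhds
      · filter_upwards [self_mem_nhdsWithin] with x hx
        simpa using hx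
    refine ht.frequently (Eventually.frequently (Eventually.of_forall fun x => ?_))
    simp [h x]
  -- On the connected plane, infinite order at one point forces infinite order everywhere.
  have h1 : meromorphicOrderAt (f - g) s₀ = ⊤ := by
    by_contra hne
    exact hd.exists_meromorphicOrderAt_ne_top_iff_forall.1 ⟨s₀, hne⟩ 0 h0
  rw [meromorphicOrderAt_eq_top_iff] at h1
  filter_upwards [h1] with s hs
  exact sub_eq_zero.1 hs

/-- Cauchy's formula at `s₀` for `c + (s - s₀) h(s)`. -/
theorem hasResidueAt_of_eventuallyEq {G h : ℂ → ℂ} {s₀ c : ℂ} (hh : AnalyticAt ℂ h s₀)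
    (hG : ∀ᶠ s in 𝓝[≠] s₀, G s = (s - s₀)⁻¹ * c + h s) : HasResidueAt G s₀ c := by
  obtain ⟨ε, hε, hball⟩ := Metric.eventually_nhds_iff_ball.1
    ((eventually_nhdsWithin_iff.1 hG).and hh.eventually_analyticAt)
  filter_upwards [Ioo_mem_nhdsGT hε] with ρ hρ
  have hd : DifferentiableOn ℂ (fun s => c + (s - s₀) * h s) (Metric.closedBall s₀ ρ) := by
    intro s hs
    have := (hball s (Metric.closedBall_subset_ball hρ.2 hs)).2.differentiableAt
    exact DifferentiableAt.differentiableWithinAt (by fun_prop)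
  have h1 := hd.circleIntegral_sub_inv_smul (Metric.mem_ball_self hρ.1)
  have h2 : (∮ s in C(s₀, ρ), G s) = ∮ s in C(s₀, ρ), (s - s₀)⁻¹ • (c + (s - s₀) * h s) := by
    refine circleIntegral.integral_congr hρ.1.le fun s hs => ?_
    have hne : s - s₀ ≠ 0 := sub_ne_zero.2 (Metric.ne_of_mem_sphere hs hρ.1.ne')
    have := (hball s (Metric.closedBall_subset_ball hρ.2 (Metric.sphere_subset_closedBall hs))).1
      (sub_ne_zero.1 hne)
    change G s = (s - s₀)⁻¹ • (c + (s - s₀) * h s)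
    rw [this, smul_eq_mul, mul_add, inv_mul_cancel_left₀ hne]
  rw [h2, h1, sub_self, zero_mul, add_zero, smul_eq_mul, inv_mul_cancel_left₀]
  exact Complex.two_pi_I_ne_zero

end Meromorphic

/-! ### The trace formula and the theorem. -/

section Main

variable {E : Type*} [NormedAddCommGroup E] [InnerProductSpace ℂ E] [CompleteSpace E]
  {K : Type*} [NormedAddCommGroup K] [InnerProductSpace ℂ K] [CompleteSpace K]

/-- Replacing the adjoint by the resolvent at `z̄` leaves an expression holomorphic in `s`, which
can leave the real line. -/
theorem imResolventMul_eq {H₀ : E →ₗ.[ℂ] E} (hH : H₀.IsFormalAdjoint H₀) {V R R' : E →L[ℂ] E}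
    (hV : IsSelfAdjoint V) {z : ℂ} (hR : IsResolventAt H₀ z R)
    (hR' : IsResolventAt H₀ (starRingEnd ℂ z) R') {s : ℝ}
    (hu : IsUnit (1 + (s : ℂ) • (R ∘L V))) (hu' : IsUnit (1 + (s : ℂ) • (R' ∘L V))) :
    imResolventMul H₀ V z s = ((2 * Real.pi * Complex.I)⁻¹ •
      (invOneAdd (R ∘L V) s ∘L R - invOneAdd (R' ∘L V) s ∘L R')) ∘L V := by
  have h := isResolventAt_path hR hu
  have h' := isResolventAt_path hR' hu'
  rw [imResolventMul, resolventOp_eq h, imaginaryPart_apply_coe, star_eq_adjoint,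
    adjoint_eq_of_isResolventAt (isFormalAdjoint_path hH hV s) h h', ← smul_comp]
  congr 1
  rw [← Complex.coe_smul, smul_smul, smul_smul]
  congr 1
  push_cast
  have hpi : (Real.pi : ℂ) ≠ 0 := by exact_mod_cast Real.pi_ne_zero
  field_simp
  simp

end Main

end ResonanceIndex

end

theorem mainTheorem4
    {H : Type*} [NormedAddCommGroup H] [InnerProductSpace ℂ H] [CompleteSpace H]
    [TopologicalSpace.SeparableSpace H]
    {K : Type*} [NormedAddCommGroup K] [InnerProductSpace ℂ K] [CompleteSpace K]
    (F : H →L[ℂ] K) (hF : ResonanceIndex.IsFrame F)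
    (H₀ : H →ₗ.[ℂ] H) (hH₀ : IsSelfAdjoint H₀)
    (J : K →L[ℂ] K) (hJ : IsSelfAdjoint J)
    (V : H →L[ℂ] H) (hV : V = ContinuousLinearMap.adjoint F ∘L J ∘L F)
    (z : ℂ) (hz : z.im ≠ 0) :
    (∀ s : ℝ, ResonanceIndex.IsTraceClass (ResonanceIndex.imResolventMul H₀ V z s)) ∧
    (∃ G : ℂ → ℂ, ResonanceIndex.IsMeromorphicExtension H₀ V z G) ∧
    ∀ G : ℂ → ℂ, ResonanceIndex.IsMeromorphicExtension H₀ V z G →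
      ∀ s₀ : ℂ, ResonanceIndex.IsPole G s₀ →
        s₀.im ≠ 0 ∧
        ∃ Np Nm : ℕ,
          Module.rank ℂ (ResonanceIndex.rootSpace
            (ResonanceIndex.resolventOp H₀ z ∘L V) (-s₀⁻¹)) = Np ∧
          Module.rank ℂ (ResonanceIndex.rootSpace
            (ResonanceIndex.resolventOp H₀ (starRingEnd ℂ z) ∘L V) (-s₀⁻¹)) = Nm ∧
          ∃ a : ℂ, ResonanceIndex.HasResidueAt G s₀ a ∧
            2 * Real.pi * Complex.I * a = (Np : ℂ) - (Nm : ℂ) := by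
  open ResonanceIndex ContinuousLinearMap Filter Topology in
  have hz' : (starRingEnd ℂ z).im ≠ 0 := by simpa using hz
  have hsym := isFormalAdjoint_of_isSelfAdjoint hH₀
  obtain ⟨R, hR⟩ := exists_isResolventAt hH₀ hz
  obtain ⟨R', hR'⟩ := exists_isResolventAt hH₀ hz'
  rw [resolventOp_eq hR, resolventOp_eq hR']
  set Q : K →L[ℂ] H := adjoint F ∘L J with hQdef
  replace hV : V = Q ∘L F := hV
  have hVsa : IsSelfAdjoint V := by
    rw [hV, hQdef, isSelfAdjoint_iff, star_eq_adjoint, adjoint_comp, adjoint_comp, adjoint_adjoint,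
      ← star_eq_adjoint, hJ.star_eq]
    rfl
  have hP : hsSq F ≠ ⊤ := hF.hilbertSchmidt.hsSq_ne_top
  have hQ : hsSq (adjoint Q) ≠ ⊤ := by
    rw [hQdef, adjoint_comp, adjoint_adjoint]
    exact hsSq_comp_ne_top _ hP
  have hc (S : H →L[ℂ] H) : IsCompactOperator (S ∘L V) := by
    rw [hV]
    exact (isCompactOperator_of_hsSq_ne_top hP).clm_comp (S ∘L Q)
  have htc (S : H →L[ℂ] H) : IsTraceClass (S ∘L V) := by
    rw [hV]
    refine isTraceClass_comp (Q := S ∘L Q) hP ?_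
    rw [adjoint_comp]
    exact hsSq_comp_ne_top' _ hQ
  have hu (s : ℝ) := isUnit_one_add_real_smul hsym hVsa hz hR (hc R) s
  have hu' (s : ℝ) := isUnit_one_add_real_smul hsym hVsa hz' hR' (hc R') s
  set g : ℂ → ℂ := fun s => trace (invOneAdd (R ∘L V) s ∘L R ∘L V) with hg
  set g' : ℂ → ℂ := fun s => trace (invOneAdd (R' ∘L V) s ∘L R' ∘L V) with hg'
  set κ : ℂ := (2 * Real.pi * Complex.I)⁻¹ with hκ
  set G₀ : ℂ → ℂ := fun s => κ * (g s - g' s) with hG₀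
  have hfd (S : H →L[ℂ] H) {s₀ : ℂ} (hs₀ : s₀ ≠ 0) :
      FiniteDimensional ℂ (rootSpace (S ∘L V) (-s₀⁻¹)) := by
    rw [hV]
    refine finiteDimensional_rootSpace (Q := S ∘L Q) hP ?_ (neg_ne_zero.2 (inv_ne_zero hs₀))
    rw [adjoint_comp]
    exact hsSq_comp_ne_top' _ hQ
  have hloc {s₀ : ℂ} (hs₀ : s₀ ≠ 0) : ∃ h : ℂ → ℂ, AnalyticAt ℂ h s₀ ∧ ∀ᶠ s in 𝓝[≠] s₀,
      G₀ s = (s - s₀)⁻¹ * (κ * (Module.finrank ℂ (rootSpace (R ∘L V) (-s₀⁻¹)) -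
        Module.finrank ℂ (rootSpace (R' ∘L V) (-s₀⁻¹)))) + h s := by
    obtain ⟨h, hh, he⟩ := exists_analyticAt_trace_eq R hP hQ hs₀
    obtain ⟨h', hh', he'⟩ := exists_analyticAt_trace_eq R' hP hQ hs₀
    refine ⟨fun s => κ * (h s - h' s), by fun_prop, ?_⟩
    filter_upwards [he, he'] with s e e'
    rw [← hV] at e e'
    simp only [hG₀, hg, hg', e, e']
    ring
  have han (s : ℝ) : AnalyticAt ℂ G₀ s := by
    have h1 := hu s
    have h2 := hu' s
    rw [hV] at h1 h2
    have h3 := analyticAt_trace R hP hQ h1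
    have h4 := analyticAt_trace R' hP hQ h2
    rw [← hV] at h3 h4
    exact analyticAt_const.mul (h3.sub h4)
  have hmer : Meromorphic G₀ := by
    intro s₀
    rcases eq_or_ne s₀ 0 with rfl | hs₀
    -- The local expansion excludes `0`, where `-1/s₀` has no meaning; there, real analyticity
    -- points already include `0`.
    · exact_mod_cast (han 0).meromorphicAt
    · obtain ⟨h, hh, he⟩ := hloc hs₀
      refine MeromorphicAt.congr ?_ (he.mono fun s hs => hs.symm)
      have := hh.meromorphicAt
      fun_prop
  have hext : IsMeromorphicExtension H₀ V z G₀ := by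
    refine ⟨hmer, fun s => ?_⟩
    obtain ⟨τ, hτ⟩ := exists_trace_functional hP hQ
    rw [imResolventMul_eq hsym hVsa hR hR' (hu s) (hu' s)]
    rw [← hV] at hτ
    rw [← hτ, map_smul, map_sub, hτ, hτ]
    rfl
  refine ⟨fun s => ?_, ⟨G₀, hext⟩, fun G hG s₀ hpole => ?_⟩
  · rw [imResolventMul_eq hsym hVsa hR hR' (hu s) (hu' s)]
    exact htc _
  · have heq : G =ᶠ[𝓝[≠] s₀] G₀ :=
      eventuallyEq_of_eq_on_real hG.1 hmer (fun s => (hG.2 s).trans (hext.2 s).symm) s₀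
    have him : s₀.im ≠ 0 := by
      intro him
      have h1 : ((s₀.re : ℝ) : ℂ) = s₀ := Complex.ext rfl (by simp [him])
      -- A real `s₀` would be a point of analyticity of `G₀`, and `G` has the same order there.
      have h2 := (han s₀.re).meromorphicOrderAt_nonneg
      rw [h1, ← meromorphicOrderAt_congr heq] at h2
      exact h2.not_gt hpole.2
    have hs₀ : s₀ ≠ 0 := fun h => him (by simp [h])
    obtain ⟨h, hh, he⟩ := hloc hs₀
    have := hfd R hs₀
    have := hfd R' hs₀
    have hr := Module.finrank_eq_rank ℂ (rootSpace (R ∘L V) (-s₀⁻¹))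
    have hr' := Module.finrank_eq_rank ℂ (rootSpace (R' ∘L V) (-s₀⁻¹))
    have hres := hasResidueAt_of_eventuallyEq hh (heq.trans he)
    refine ⟨him, _, _, hr.symm, hr'.symm, _, hres, ?_⟩
    rw [hκ, mul_inv_cancel_left₀ Complex.two_pi_I_ne_zero]
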